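/- **Theorem 3.** Let $\mathcal H$ be a complex Hilbert space of arbitrary (finite or infinite) dimension, $\mathcal L(\mathcal H)$ the space of bounded operators on it, $\mathcal T(\mathcal H)\subseteq\mathcal L(\mathcal H)$ the space of trace class operators and $\|T\|_1=\operatorname{tr}|T|$ the trace norm. A *channel* is a bounded, completely positive, trace preserving linear map $\Lambda:\mathcal T(\mathcal H)\to\mathcal T(\mathcal H)$. An *instrument* with outcomes $1,\dots,r$ is a family $\mathcal M=(\mathcal M(j))_{j=1}^r$ of bounded completely positive linear maps on $\mathcal T(\mathcal H)$ with $\sum_j \operatorname{tr}\{\mathcal M(j)[T]\}=\operatorname{tr}\{T\}$ for all $T\in\mathcal T(\mathcal H)$. Let $\Lambda_1,\Lambda_2$ be channels, $r\ge 2$, let $\rho_1,\dots,\rho_r$ be states (positive trace class operators of unit trace) on $\mathcal H$ and $q_1,\dots,q_r>0$ with $\sum_j q_j=1$. For an instrument $\mathcal M_1$ put $$P_{\mathcal M_1}(\Lambda_1[\rho_1],\dots,\Lambda_1[\rho_r]\mid q)=\sum_{j=1}^r q_j\operatorname{tr}\{\mathcal M_1(j)[\Lambda_1[\rho_j]]\},$$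 $$B(\mathcal M_1)=P_{\mathcal M_1}(\Lambda_1[\rho_1],\dots,\Lambda_1[\rho_r]\mid q)+\sum_{1\le i<j\le r}\bigl\|\Lambda_2\bigl[q_i\mathcal M_1(i)[\Lambda_1[\rho_i]]-q_j\mathcal M_1(j)[\Lambda_1[\rho_j]]\bigr]\bigr\|_1 ,$$ and define the optimal success probability of the two-sequential discrimination under noise by $$P^{opt}=\sup_{\mathcal M_1,\mathcal M_2}\ \sum_{j=1}^r q_j\operatorname{tr}\{\mathcal M_2(j)[\Lambda_2[\mathcal M_1(j)[\Lambda_1[\rho_j]]]]\},$$ the supremum being over all pairs of instruments with outcomes $1,\dots,r$. This supremum and $\sup_{\mathcal M_1}B(\mathcal M_1)$ are finite, and both are maxima if $\dim\mathcal H<\infty$. Moreover, $$P^{opt}\le\frac1r\,\sup_{\mathcal M_1}B(\mathcal M_1),$$ where, for every instrument $\mathcal M_1$, $$P_{\mathcal M_1}(\Lambda_1[\rho_1],\dots,\Lambda_1[\rho_r]\mid q)\le\frac1r\Bigl(1+\sum_{1\le i<j\le r}\bigl\|\Lambda_1[q_i\rho_i-q_j\rho_j]\bigr\|_1\Bigr).$$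 For $r=2$ the first bound is an equality: $$P^{opt}=\sup_{\mathcal M_1}\frac12\Bigl(P_{\mathcal M_1}(\Lambda_1[\rho_1],\Lambda_1[\rho_2]\mid q_1,q_2)+\bigl\|\Lambda_2\bigl[q_1\mathcal M_1(1)[\Lambda_1[\rho_1]]-q_2\mathcal M_1(2)[\Lambda_1[\rho_2]]\bigr]\bigr\|_1\Bigr).$$ -/

import Mathlib

open scoped InnerProductSpace ComplexOrder

namespace QuantumDiscrimination

/-- The index set of a fixed Hilbert basis of `H`. -/
noncomputable def basisIndex (H : Type*) [NormedAddCommGroup H] [InnerProductSpace ℂ H]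
    [CompleteSpace H] : Set H :=
  (exists_hilbertBasis ℂ H).choose

/-- A fixed Hilbert basis of `H` (traces do not depend on this choice). -/
noncomputable def basis (H : Type*) [NormedAddCommGroup H] [InnerProductSpace ℂ H]
    [CompleteSpace H] : HilbertBasis (basisIndex H) ℂ H :=
  (exists_hilbertBasis ℂ H).choose_spec.choose

section TraceClass

variable {H : Type*} [NormedAddCommGroup H] [InnerProductSpace ℂ H] [CompleteSpace H]

/-- `T` is trace class if `∑ᵢ ⟨eᵢ, |T| eᵢ⟩` converges, where `|T| = (T† T)^{1/2}`. -/
def IsTraceClass (T : H →L[ℂ] H) : Prop :=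
  Summable fun i => (⟪basis H i, CFC.abs T (basis H i)⟫_ℂ).re

/-- The trace norm `‖T‖₁ = tr |T|`. -/
noncomputable def traceNorm (T : H →L[ℂ] H) : ℝ :=
  ∑' i, (⟪basis H i, CFC.abs T (basis H i)⟫_ℂ).re

/-- The trace `tr T = ∑ᵢ ⟨eᵢ, T eᵢ⟩`. -/
noncomputable def trace (T : H →L[ℂ] H) : ℂ :=
  ∑' i, ⟪basis H i, T (basis H i)⟫_ℂ

theorem parseval (x : H) :
    ∑' i, ENNReal.ofReal (‖⟪basis H i, x⟫_ℂ‖ ^ 2) = ENNReal.ofReal (‖x‖ ^ 2) := by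
  have h := (basis H).hasSum_inner_mul_inner x x
  have h2 : HasSum (fun i => ‖⟪basis H i, x⟫_ℂ‖ ^ 2) (‖x‖ ^ 2) := by
    have h3 := Complex.hasSum_re h
    convert h3 using 1
    · funext i
      rw [← inner_conj_symm x, RCLike.conj_mul]
      norm_cast
    · rw [inner_self_eq_norm_sq_to_K]
      norm_cast
  rw [← h2.tsum_eq, ENNReal.ofReal_tsum_of_nonneg (fun _ => by positivity) h2.summable]

theorem tsum_norm_sq_star (A : H →L[ℂ] H) :
    ∑' i, ENNReal.ofReal (‖star A (basis H i)‖ ^ 2) =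
      ∑' i, ENNReal.ofReal (‖A (basis H i)‖ ^ 2) := by
  simp_rw [← parseval (H := H)]
  rw [ENNReal.tsum_comm]
  refine tsum_congr fun i => tsum_congr fun j => ?_
  rw [ContinuousLinearMap.star_eq_adjoint, ContinuousLinearMap.adjoint_inner_right,
    norm_inner_symm]

theorem tsum_norm_sq_mul_le (A C : H →L[ℂ] H) (hC : ‖C‖ ≤ 1) :
    ∑' i, ENNReal.ofReal (‖(A * C) (basis H i)‖ ^ 2) ≤
      ∑' i, ENNReal.ofReal (‖A (basis H i)‖ ^ 2) := by
  rw [← tsum_norm_sq_star, ← tsum_norm_sq_star A]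
  refine ENNReal.tsum_le_tsum fun i => ENNReal.ofReal_le_ofReal ?_
  rw [star_mul]
  have : ‖(star C) (star A (basis H i))‖ ≤ 1 * ‖star A (basis H i)‖ :=
    (star C).le_of_opNorm_le (by rwa [norm_star]) _
  rw [one_mul] at this
  exact pow_le_pow_left₀ (norm_nonneg _) this 2

theorem inner_abs_eq (T : H →L[ℂ] H) (x : H) :
    (⟪x, CFC.abs T x⟫_ℂ).re = ‖CFC.sqrt (CFC.abs T) x‖ ^ 2 := by
  have h : CFC.abs T = star (CFC.sqrt (CFC.abs T)) * CFC.sqrt (CFC.abs T) := by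
    rw [(CFC.sqrt_nonneg (CFC.abs T)).star_eq, CFC.sqrt_mul_sqrt_self _ (CFC.abs_nonneg T)]
  conv_lhs => rw [h]
  rw [_root_.mul_apply_eq_comp, ContinuousLinearMap.star_eq_adjoint,
    ContinuousLinearMap.adjoint_inner_right, inner_self_eq_norm_sq_to_K]
  norm_cast

/-- Approximate polar decomposition. -/
theorem exists_approx_polar (X : H →L[ℂ] H) {ε : ℝ} (hε : 0 < ε) :
    ∃ V : H →L[ℂ] H, ‖V‖ ≤ 1 ∧ ‖V * CFC.abs X - X‖ ≤ ε ∧ ‖star V * X - CFC.abs X‖ ≤ ε := by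
  set P := CFC.abs X with hP
  have hP0 : 0 ≤ P := CFC.abs_nonneg X
  have hPsa : IsSelfAdjoint P := .of_nonneg hP0
  have hPP : star X * X = P * P := (CFC.abs_mul_abs X).symm
  have hsp : ∀ t ∈ spectrum ℝ P, 0 ≤ t := fun t ht => spectrum_nonneg_of_nonneg hP0 ht
  have hc : ContinuousOn (fun t : ℝ => (t + ε)⁻¹) (spectrum ℝ P) :=
    ContinuousOn.inv₀ (by fun_prop) fun t ht => by have := hsp t ht; positivity
  set R := cfc (fun t : ℝ => (t + ε)⁻¹) P with hR
  have hRsa : star R = R := (IsSelfAdjoint.cfc (f := fun t : ℝ => (t + ε)⁻¹) (a := P)).star_eq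
  have hid : P = cfc (fun t : ℝ => t) P := (cfc_id' ℝ P).symm
  have hRP : R * P = cfc (fun t : ℝ => (t + ε)⁻¹ * t) P := by
    rw [cfc_mul (fun t : ℝ => (t + ε)⁻¹) (fun t => t) P hc (continuousOn_id' _), ← hid]
  have hc2 : ContinuousOn (fun t : ℝ => (t + ε)⁻¹ * t) (spectrum ℝ P) := hc.mul (continuousOn_id' _)
  have hPR : P * R = cfc (fun t : ℝ => (t + ε)⁻¹ * t) P := by
    rw [cfc_mul (fun t : ℝ => (t + ε)⁻¹) (fun t => t) P hc (continuousOn_id' _), ← hid]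
    have hcomm := (cfc_commute_cfc (fun t : ℝ => t) (fun t : ℝ => (t + ε)⁻¹) P).eq
    rwa [← hid] at hcomm
  have key : ∀ K : H →L[ℂ] H, star K = K → ∀ c : ℝ, 0 ≤ c → ‖P * K‖ ≤ c → ‖X * K‖ ≤ c := by
    intro K hK c hc0 h
    have h1 : ‖X * K‖ * ‖X * K‖ = ‖P * K‖ * ‖P * K‖ := by
      rw [← CStarRing.norm_star_mul_self, ← CStarRing.norm_star_mul_self, star_mul, star_mul,
        hPsa.star_eq, hK, mul_assoc, ← mul_assoc (star X), hPP]
      simp only [mul_assoc]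
    have h2 : ‖X * K‖ = ‖P * K‖ := by
      nlinarith [norm_nonneg (X * K), norm_nonneg (P * K), mul_self_inj (norm_nonneg (X * K)) (norm_nonneg (P * K)) |>.1 h1]
    rwa [h2]
  refine ⟨X * R, ?_, ?_, ?_⟩
  · refine key R hRsa 1 zero_le_one ?_
    rw [hPR]
    refine norm_cfc_le zero_le_one fun t ht => ?_
    have := hsp t ht
    rw [Real.norm_of_nonneg (by positivity), inv_mul_le_iff₀ (by positivity)]
    linarith
  · have h1 : X * R * P - X = X * (R * P - 1) := by rw [mul_sub, mul_one, mul_assoc]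
    rw [h1]
    have h2 : R * P - 1 = cfc (fun t : ℝ => (t + ε)⁻¹ * t - 1) P := by
      rw [cfc_sub (fun t : ℝ => (t + ε)⁻¹ * t) (fun _ => 1) P hc2 continuousOn_const, ← hRP]
      simp [cfc_const_one ℝ P]
    have hc3 : ContinuousOn (fun t : ℝ => (t + ε)⁻¹ * t - 1) (spectrum ℝ P) :=
      hc2.sub continuousOn_const
    refine key _ ?_ ε hε.le ?_
    · rw [h2]
      exact (IsSelfAdjoint.cfc (f := fun t : ℝ => (t + ε)⁻¹ * t - 1) (a := P)).star_eq
    · have h3 : P * (R * P - 1) = cfc (fun t : ℝ => t * ((t + ε)⁻¹ * t - 1)) P := by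
        rw [cfc_mul (fun t : ℝ => t) (fun t : ℝ => (t + ε)⁻¹ * t - 1) P (continuousOn_id' _) hc3,
          ← hid, h2]
      rw [h3]
      refine norm_cfc_le hε.le fun t ht => ?_
      have := hsp t ht
      have h4 : t * ((t + ε)⁻¹ * t - 1) = -(ε * ((t + ε)⁻¹ * t)) := by
        field_simp
        ring
      have h5 : (t + ε)⁻¹ * t ≤ 1 := by
        rw [inv_mul_le_iff₀ (by positivity)]
        linarith
      rw [h4, norm_neg, Real.norm_of_nonneg (by positivity)]
      nlinarith
  · have h1 : star (X * R) * X - P = (R * P) * P - P := by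
      rw [star_mul, hRsa, mul_assoc, hPP, mul_assoc]
    have h2 : (R * P) * P - P = cfc (fun t : ℝ => (t + ε)⁻¹ * t * t - t) P := by
      rw [cfc_sub (fun t : ℝ => (t + ε)⁻¹ * t * t) (fun t => t) P (hc2.mul (continuousOn_id' _))
        (continuousOn_id' _), cfc_mul (fun t : ℝ => (t + ε)⁻¹ * t) (fun t => t) P hc2
        (continuousOn_id' _), ← hid, ← hRP]
    rw [h1, h2]
    refine norm_cfc_le hε.le fun t ht => ?_
    have := hsp t ht
    have h4 : (t + ε)⁻¹ * t * t - t = -(ε * ((t + ε)⁻¹ * t)) := by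
      field_simp
      ring
    have h5 : (t + ε)⁻¹ * t ≤ 1 := by
      rw [inv_mul_le_iff₀ (by positivity)]
      linarith
    rw [h4, norm_neg, Real.norm_of_nonneg (by positivity)]
    nlinarith

theorem sum_norm_sq_le (T : H →L[ℂ] H) (hT : IsTraceClass T) (C : H →L[ℂ] H) (hC : ‖C‖ ≤ 1)
    (s : Finset (basisIndex H)) :
    ∑ i ∈ s, ‖(CFC.sqrt (CFC.abs T) * C) (basis H i)‖ ^ 2 ≤ traceNorm T := by
  have h0 : 0 ≤ traceNorm T := tsum_nonneg fun i => by rw [inner_abs_eq]; positivity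
  rw [← ENNReal.ofReal_le_ofReal_iff h0, ENNReal.ofReal_sum_of_nonneg fun _ _ => by positivity]
  refine (ENNReal.sum_le_tsum s).trans ((tsum_norm_sq_mul_le _ C hC).trans (le_of_eq ?_))
  rw [traceNorm, ENNReal.ofReal_tsum_of_nonneg (fun i => by rw [inner_abs_eq]; positivity) hT]
  exact tsum_congr fun i => by rw [inner_abs_eq]

theorem sum_norm_inner_le (T : H →L[ℂ] H) (hT : IsTraceClass T) (C : H →L[ℂ] H) (hC : ‖C‖ ≤ 1)
    (s : Finset (basisIndex H)) :
    ∑ i ∈ s, ‖⟪C (basis H i), T (basis H i)⟫_ℂ‖ ≤ traceNorm T := by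
  refine le_of_forall_pos_le_add fun δ hδ => ?_
  obtain ⟨V, hV, hVT, -⟩ := exists_approx_polar T (ε := δ / (s.card + 1)) (by positivity)
  set A := CFC.sqrt (CFC.abs T) with hA
  have hAsa : star A = A := (CFC.sqrt_nonneg (CFC.abs T)).star_eq
  have hAA : A * A = CFC.abs T := CFC.sqrt_mul_sqrt_self _ (CFC.abs_nonneg T)
  have hVC : ‖star V * C‖ ≤ 1 := by
    refine (norm_mul_le _ _).trans ?_
    rw [norm_star]
    exact mul_le_one₀ hV (norm_nonneg _) hC
  have term : ∀ i, ‖⟪C (basis H i), T (basis H i)⟫_ℂ‖ ≤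
      (‖(A * (star V * C)) (basis H i)‖ ^ 2 + ‖(A * 1) (basis H i)‖ ^ 2) / 2
        + δ / (s.card + 1) := by
    intro i
    have h1 : T (basis H i) = (V * CFC.abs T) (basis H i)
        - (V * CFC.abs T - T) (basis H i) := by simp
    have hb : ‖basis H i‖ = 1 := (basis H).orthonormal.1 i
    have h2 : ‖⟪C (basis H i), (V * CFC.abs T - T) (basis H i)⟫_ℂ‖ ≤ δ / (s.card + 1) := by
      refine (norm_inner_le_norm _ _).trans ?_
      have a1 : ‖C (basis H i)‖ ≤ 1 * ‖basis H i‖ := C.le_of_opNorm_le hC _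
      have a2 := (V * CFC.abs T - T).le_of_opNorm_le hVT (basis H i)
      rw [hb, mul_one] at a1 a2
      exact (mul_le_mul a1 a2 (norm_nonneg _) zero_le_one).trans (by rw [one_mul])
    have h3 : ⟪C (basis H i), (V * CFC.abs T) (basis H i)⟫_ℂ =
        ⟪(A * (star V * C)) (basis H i), (A * 1) (basis H i)⟫_ℂ := by
      have e1 : (A * (star V * C)) (basis H i) = star A (star V (C (basis H i))) := by
        rw [hAsa]; rfl
      rw [e1, ContinuousLinearMap.star_eq_adjoint, ContinuousLinearMap.star_eq_adjoint,
        ContinuousLinearMap.adjoint_inner_left, ContinuousLinearMap.adjoint_inner_left, mul_one,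
        ← hAA]
      rfl
    have h4 : ‖⟪C (basis H i), (V * CFC.abs T) (basis H i)⟫_ℂ‖ ≤
        (‖(A * (star V * C)) (basis H i)‖ ^ 2 + ‖(A * 1) (basis H i)‖ ^ 2) / 2 := by
      rw [h3]
      refine (norm_inner_le_norm _ _).trans ?_
      nlinarith [sq_nonneg (‖(A * (star V * C)) (basis H i)‖ - ‖(A * 1) (basis H i)‖)]
    rw [h1, inner_sub_right]
    exact (norm_sub_le _ _).trans (add_le_add h4 h2)
  refine (Finset.sum_le_sum fun i _ => term i).trans ?_
  rw [Finset.sum_add_distrib, ← Finset.sum_div, Finset.sum_add_distrib, Finset.sum_const,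
    nsmul_eq_mul]
  have b1 := sum_norm_sq_le T hT (star V * C) hVC s
  have b2 := sum_norm_sq_le T hT 1 ContinuousLinearMap.norm_id_le s
  have b3 : (s.card : ℝ) * (δ / (s.card + 1)) ≤ δ := by
    rw [mul_div_assoc', div_le_iff₀ (by positivity)]
    nlinarith
  linarith

theorem IsTraceClass.add {S T : H →L[ℂ] H} (hS : IsTraceClass S) (hT : IsTraceClass T) :
    IsTraceClass (S + T) := by
  refine summable_of_sum_le (c := traceNorm S + traceNorm T)
    (fun i => by rw [Pi.zero_apply, inner_abs_eq]; positivity) fun s => ?_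
  refine le_of_forall_pos_le_add fun δ hδ => ?_
  obtain ⟨V, hV, -, hVT⟩ := exists_approx_polar (S + T) (ε := δ / (s.card + 1)) (by positivity)
  have term : ∀ i, (⟪basis H i, CFC.abs (S + T) (basis H i)⟫_ℂ).re ≤
      ‖⟪V (basis H i), S (basis H i)⟫_ℂ‖ + ‖⟪V (basis H i), T (basis H i)⟫_ℂ‖
        + δ / (s.card + 1) := by
    intro i
    have hb : ‖basis H i‖ = 1 := (basis H).orthonormal.1 i
    have h1 : CFC.abs (S + T) (basis H i) = star V (S (basis H i)) + star V (T (basis H i))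
        - (star V * (S + T) - CFC.abs (S + T)) (basis H i) := by simp
    have h2 : ‖⟪basis H i, (star V * (S + T) - CFC.abs (S + T)) (basis H i)⟫_ℂ‖ ≤
        δ / (s.card + 1) := by
      refine (norm_inner_le_norm _ _).trans ?_
      have a2 := (star V * (S + T) - CFC.abs (S + T)).le_of_opNorm_le hVT (basis H i)
      rw [hb, mul_one] at a2
      rwa [hb, one_mul]
    refine (Complex.re_le_norm _).trans ?_
    rw [h1, inner_sub_right, inner_add_right, ContinuousLinearMap.star_eq_adjoint,
      ContinuousLinearMap.adjoint_inner_right, ContinuousLinearMap.adjoint_inner_right]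
    rw [ContinuousLinearMap.star_eq_adjoint] at h2
    exact (norm_sub_le _ _).trans (add_le_add (norm_add_le _ _) h2)
  refine (Finset.sum_le_sum fun i _ => term i).trans ?_
  rw [Finset.sum_add_distrib, Finset.sum_add_distrib, Finset.sum_const, nsmul_eq_mul]
  have b1 := sum_norm_inner_le S hS V hV s
  have b2 := sum_norm_inner_le T hT V hV s
  have b3 : (s.card : ℝ) * (δ / (s.card + 1)) ≤ δ := by
    rw [mul_div_assoc', div_le_iff₀ (by positivity)]
    nlinarith
  linarith

theorem IsTraceClass.smul (c : ℂ) {T : H →L[ℂ] H} (hT : IsTraceClass T) :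
    IsTraceClass (c • T) := by
  unfold IsTraceClass at hT ⊢
  have h : CFC.abs (c • T) = ‖c‖ • CFC.abs T := CFC.abs_smul c T
  have h2 := hT.mul_left ‖c‖
  refine h2.congr fun i => ?_
  rw [h, _root_.smul_apply, inner_smul_right_eq_smul, Complex.smul_re, smul_eq_mul]

variable (H) in
/-- The vector space `𝒯(H)` of trace class operators on `H`. -/
def traceClass : Submodule ℂ (H →L[ℂ] H) where
  carrier := {T | IsTraceClass T}
  add_mem' hS hT := hS.add hT
  zero_mem' := by
    simp only [Set.mem_ofPred_eq, IsTraceClass, CFC.abs_zero, _root_.zero_apply,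
      inner_zero_right, Complex.zero_re]
    exact summable_zero
  smul_mem' c _ hT := hT.smul c

/-- A linear map `Φ` on `𝒯(H)` is completely positive if, for every `n`, the map `id ⊗ Φ` sends
positive `n × n` block operators with entries in `𝒯(H)` to positive block operators. -/
def IsCompletelyPositive (Φ : traceClass H →ₗ[ℂ] traceClass H) : Prop :=
  ∀ (n : ℕ) (T : Fin n → Fin n → traceClass H),
    (∀ x : Fin n → H, 0 ≤ ∑ i, ∑ j, ⟪x i, (T i j : H →L[ℂ] H) (x j)⟫_ℂ) →
    ∀ x : Fin n → H, 0 ≤ ∑ i, ∑ j, ⟪x i, (Φ (T i j) : H →L[ℂ] H) (x j)⟫_ℂ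

/-- Boundedness with respect to the trace norm. -/
def IsTraceNormBounded (Φ : traceClass H →ₗ[ℂ] traceClass H) : Prop :=
  ∃ C : ℝ, ∀ T : traceClass H, traceNorm (Φ T : H →L[ℂ] H) ≤ C * traceNorm (T : H →L[ℂ] H)

/-- A quantum state: a positive trace class operator with unit trace. -/
def IsState (ρ : traceClass H) : Prop :=
  (ρ : H →L[ℂ] H).IsPositive ∧ trace (ρ : H →L[ℂ] H) = 1

variable (H) in
/-- A quantum channel: a bounded completely positive trace preserving linear map on `𝒯(H)`. -/
structure Channel where
  map : traceClass H →ₗ[ℂ] traceClass H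
  completelyPositive : IsCompletelyPositive map
  bounded : IsTraceNormBounded map
  trace_map : ∀ T : traceClass H, trace (map T : H →L[ℂ] H) = trace (T : H →L[ℂ] H)

variable (H) in
/-- A state instrument with outcomes in a set of `r` elements. -/
structure Instrument (r : ℕ) where
  map : Fin r → traceClass H →ₗ[ℂ] traceClass H
  completelyPositive : ∀ j, IsCompletelyPositive (map j)
  bounded : ∀ j, IsTraceNormBounded (map j)
  sum_trace : ∀ T : traceClass H,
    ∑ j, trace (map j T : H →L[ℂ] H) = trace (T : H →L[ℂ] H)

/-- The success probability of one receiver, `∑ⱼ qⱼ tr{M(j)[ρⱼ]}`. -/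
noncomputable def successProb {r : ℕ} (M : Instrument H r) (ρ : Fin r → traceClass H)
    (q : Fin r → ℝ) : ℝ :=
  ∑ j, q j * (trace (M.map j (ρ j) : H →L[ℂ] H)).re

/-- The consecutive measurement of two receivers through the noisy channels `Λ₁`, `Λ₂`:
`(j₁, j₂) ↦ M₂(j₂) ∘ Λ₂ ∘ M₁(j₁) ∘ Λ₁`. -/
def consecutive {r : ℕ} (Λ₁ Λ₂ : Channel H) (M₁ M₂ : Instrument H r) (j₁ j₂ : Fin r) :
    traceClass H →ₗ[ℂ] traceClass H :=
  M₂.map j₂ ∘ₗ Λ₂.map ∘ₗ M₁.map j₁ ∘ₗ Λ₁.map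

/-- The probability that both receivers identify the state correctly. -/
noncomputable def twoSuccessProb {r : ℕ} (Λ₁ Λ₂ : Channel H) (M₁ M₂ : Instrument H r)
    (ρ : Fin r → traceClass H) (q : Fin r → ℝ) : ℝ :=
  ∑ j, q j * (trace (consecutive Λ₁ Λ₂ M₁ M₂ j j (ρ j) : H →L[ℂ] H)).re

/-- The optimal success probability of two-sequential discrimination under noise. -/
noncomputable def optSuccessProb {r : ℕ} (Λ₁ Λ₂ : Channel H) (ρ : Fin r → traceClass H)
    (q : Fin r → ℝ) : ℝ :=
  ⨆ M : Instrument H r × Instrument H r, twoSuccessProb Λ₁ Λ₂ M.1 M.2 ρ q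

/-- First-receiver success probability plus
`∑_{i<j} ‖Λ₂[qᵢ M₁(i)[Λ₁ ρᵢ] - qⱼ M₁(j)[Λ₁ ρⱼ]]‖₁`. -/
noncomputable def firstReceiverBound {r : ℕ} (Λ₁ Λ₂ : Channel H) (ρ : Fin r → traceClass H)
    (q : Fin r → ℝ) (M₁ : Instrument H r) : ℝ :=
  successProb M₁ (fun j => Λ₁.map (ρ j)) q +
    ∑ i, ∑ j ∈ Finset.Ioi i,
      traceNorm (Λ₂.map ((q i : ℂ) • M₁.map i (Λ₁.map (ρ i))
        - (q j : ℂ) • M₁.map j (Λ₁.map (ρ j))) : H →L[ℂ] H)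

end TraceClass

end QuantumDiscrimination

namespace QuantumDiscrimination

variable {H : Type*} [NormedAddCommGroup H] [InnerProductSpace ℂ H] [CompleteSpace H]

/-! Both upper bounds are instances of one inequality, `Instrument.mul_sum_le`. For an instrument M
and self-adjoint σ_j, preservation of the total trace gives Σ_j tr σ_j = Σ_{i,j} tr M(i)[σ_j]. Hence
r Σ_i tr M(i)[σ_i] - Σ_j tr σ_j is the sum over all (i, j) of tr M(i)[σ_i - σ_j]. The diagonal
vanishes, and the terms (i, j) and (j, i) combine to tr M(i)[X] - tr M(j)[X] with X = σ_i - σ_j,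
which the Jordan decomposition of X bounds by ‖X‖₁ (`Instrument.sub_le_traceNorm`).

With M = M₁ and σ_j = Λ₁[q_j ρ_j] this bounds the first receiver. With M = M₂ and σ_j the operators
reaching the second receiver (`received`) it bounds the joint success; there Σ_j tr σ_j is the first
receiver's success probability, because Λ₂ preserves the trace.

For r = 2 the second receiver can saturate the inequality whatever M₁ is: Helstrom's projection,
followed by preparation of a fixed pure state, is an instrument giving equality
(`exists_instrument_two`). So the two suprema agree.

In finite dimension the maxima come from compactness of the set of instruments
(`isCompact_instrumentSet`) and continuity of both objectives. -/

/-! ### Trace norm: triangle inequality, scaling, comparison with the operator norm. -/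

theorem traceNorm_nonneg (T : H →L[ℂ] H) : 0 ≤ traceNorm T :=
  tsum_nonneg fun i => by rw [inner_abs_eq]; positivity

/-- With a contraction V such that V†(S + T) is close to |S + T|, each diagonal entry of |S + T| is
controlled by ⟨V e, S e⟩ and ⟨V e, T e⟩, whose absolute sums are at most the trace norms. The
tolerance δ / (card + 1) keeps the total error over a finite set below δ. -/
theorem traceNorm_add_le {S T : H →L[ℂ] H} (hS : IsTraceClass S) (hT : IsTraceClass T) :
    traceNorm (S + T) ≤ traceNorm S + traceNorm T := by
  refine (hS.add hT).tsum_le_of_sum_le fun s => ?_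
  refine le_of_forall_pos_le_add fun δ hδ => ?_
  obtain ⟨V, hV, -, hVT⟩ := exists_approx_polar (S + T) (ε := δ / (s.card + 1)) (by positivity)
  have term : ∀ i, (⟪basis H i, CFC.abs (S + T) (basis H i)⟫_ℂ).re ≤
      ‖⟪V (basis H i), S (basis H i)⟫_ℂ‖ + ‖⟪V (basis H i), T (basis H i)⟫_ℂ‖
        + δ / (s.card + 1) := by
    intro i
    have hb : ‖basis H i‖ = 1 := (basis H).orthonormal.1 i
    have h1 : CFC.abs (S + T) (basis H i) = star V (S (basis H i)) + star V (T (basis H i))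
        - (star V * (S + T) - CFC.abs (S + T)) (basis H i) := by simp
    have h2 : ‖⟪basis H i, (star V * (S + T) - CFC.abs (S + T)) (basis H i)⟫_ℂ‖ ≤
        δ / (s.card + 1) := by
      refine (norm_inner_le_norm _ _).trans ?_
      have a2 := (star V * (S + T) - CFC.abs (S + T)).le_of_opNorm_le hVT (basis H i)
      rw [hb, mul_one] at a2
      rwa [hb, one_mul]
    refine (Complex.re_le_norm _).trans ?_
    rw [h1, inner_sub_right, inner_add_right, ContinuousLinearMap.star_eq_adjoint,
      ContinuousLinearMap.adjoint_inner_right, ContinuousLinearMap.adjoint_inner_right]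
    rw [ContinuousLinearMap.star_eq_adjoint] at h2
    exact (norm_sub_le _ _).trans (add_le_add (norm_add_le _ _) h2)
  refine (Finset.sum_le_sum fun i _ => term i).trans ?_
  rw [Finset.sum_add_distrib, Finset.sum_add_distrib, Finset.sum_const, nsmul_eq_mul]
  have b1 := sum_norm_inner_le S hS V hV s
  have b2 := sum_norm_inner_le T hT V hV s
  have b3 : (s.card : ℝ) * (δ / (s.card + 1)) ≤ δ := by
    rw [mul_div_assoc', div_le_iff₀ (by positivity)]
    nlinarith
  linarith

theorem traceNorm_smul (c : ℂ) (T : H →L[ℂ] H) : traceNorm (c • T) = ‖c‖ * traceNorm T := by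
  have h : CFC.abs (c • T) = ‖c‖ • CFC.abs T := CFC.abs_smul c T
  rw [traceNorm, traceNorm, ← tsum_mul_left]
  refine tsum_congr fun i => ?_
  rw [h, _root_.smul_apply, inner_smul_right_eq_smul, Complex.smul_re, smul_eq_mul]

theorem traceNorm_neg (T : H →L[ℂ] H) : traceNorm (-T) = traceNorm T := by
  rw [traceNorm, traceNorm, CFC.abs_neg]

theorem IsTraceClass.abs {T : H →L[ℂ] H} (hT : IsTraceClass T) : IsTraceClass (CFC.abs T) := by
  unfold IsTraceClass
  rwa [CFC.cfcAbs_cfcAbs]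

theorem traceNorm_abs (T : H →L[ℂ] H) : traceNorm (CFC.abs T) = traceNorm T := by
  rw [traceNorm, traceNorm, CFC.cfcAbs_cfcAbs]

/-- The Hilbert–Schmidt norm dominates the operator norm: Parseval for B x, then Cauchy–Schwarz for
⟨B† e_i, x⟩. Sums in `ENNReal` avoid any summability hypothesis. -/
theorem norm_apply_sq_le_tsum (B : H →L[ℂ] H) (x : H) :
    ENNReal.ofReal (‖B x‖ ^ 2) ≤
      (∑' i, ENNReal.ofReal (‖B (basis H i)‖ ^ 2)) * ENNReal.ofReal (‖x‖ ^ 2) := by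
  rw [← parseval, ← tsum_norm_sq_star, ← ENNReal.tsum_mul_right]
  refine ENNReal.tsum_le_tsum fun i => ?_
  rw [← ENNReal.ofReal_mul (by positivity), ← mul_pow, ContinuousLinearMap.star_eq_adjoint]
  refine ENNReal.ofReal_le_ofReal (pow_le_pow_left₀ (norm_nonneg _) ?_ 2)
  rw [← ContinuousLinearMap.adjoint_inner_left]
  exact norm_inner_le_norm _ _

/-- The operator norm is dominated by the trace norm. -/
theorem norm_le_traceNorm {T : H →L[ℂ] H} (hT : IsTraceClass T) : ‖T‖ ≤ traceNorm T := by
  -- R = |T|^{1/2} has squared Hilbert–Schmidt norm ‖T‖₁, while ‖R‖² = ‖|T|‖ = ‖T‖.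
  set R := CFC.sqrt (CFC.abs T)
  have hR : star R * R = CFC.abs T := by
    rw [(CFC.sqrt_nonneg (CFC.abs T)).star_eq, CFC.sqrt_mul_sqrt_self _ (CFC.abs_nonneg T)]
  have hHS : ∑' i, ENNReal.ofReal (‖R (basis H i)‖ ^ 2) = ENNReal.ofReal (traceNorm T) := by
    rw [traceNorm, ENNReal.ofReal_tsum_of_nonneg (fun i => by rw [inner_abs_eq]; positivity) hT]
    exact tsum_congr fun i => by rw [inner_abs_eq]
  have hle : ‖R‖ ≤ √(traceNorm T) := by
    refine R.opNorm_le_bound (Real.sqrt_nonneg _) fun x => ?_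
    have h := norm_apply_sq_le_tsum R x
    have h0 := traceNorm_nonneg T
    rw [hHS, ← ENNReal.ofReal_mul h0, ENNReal.ofReal_le_ofReal_iff (by positivity)] at h
    refine le_of_sq_le_sq ?_ (by positivity)
    rwa [mul_pow, Real.sq_sqrt h0]
  calc ‖T‖ = ‖CFC.abs T‖ := CFC.norm_abs.symm
    _ = ‖R‖ * ‖R‖ := by rw [← hR, CStarRing.norm_star_mul_self]
    _ ≤ √(traceNorm T) * √(traceNorm T) := by gcongr
    _ = traceNorm T := Real.mul_self_sqrt (traceNorm_nonneg T)

/-! ### Trace functionals and the Jordan decomposition. -/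

theorem summable_inner {T : H →L[ℂ] H} (hT : IsTraceClass T) {C : H →L[ℂ] H} (hC : ‖C‖ ≤ 1) :
    Summable fun i => ⟪C (basis H i), T (basis H i)⟫_ℂ :=
  .of_norm (summable_of_sum_le (fun _ => norm_nonneg _) (sum_norm_inner_le T hT C hC))

/-- The functional `T ↦ tr (C† T)` on trace class operators, for a contraction `C`. -/
noncomputable def traceMul (C : H →L[ℂ] H) (hC : ‖C‖ ≤ 1) : traceClass H →ₗ[ℂ] ℂ where
  toFun T := ∑' i, ⟪C (basis H i), (T : H →L[ℂ] H) (basis H i)⟫_ℂ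
  map_add' S T := by
    rw [← (summable_inner S.2 hC).tsum_add (summable_inner T.2 hC)]
    exact tsum_congr fun i => by simp
  map_smul' c T := by
    rw [RingHom.id_apply, smul_eq_mul, ← tsum_mul_left]
    exact tsum_congr fun i => by simp

theorem norm_traceMul_le (C : H →L[ℂ] H) (hC : ‖C‖ ≤ 1) (T : traceClass H) :
    ‖traceMul C hC T‖ ≤ traceNorm (T : H →L[ℂ] H) := by
  have h := summable_of_sum_le (fun _ => norm_nonneg _) (sum_norm_inner_le _ T.2 C hC)
  exact (norm_tsum_le_tsum_norm h).trans (h.tsum_le_of_sum_le (sum_norm_inner_le _ T.2 C hC))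

variable (H) in
/-- The trace as a linear functional on trace class operators. -/
noncomputable def traceLM : traceClass H →ₗ[ℂ] ℂ :=
  traceMul 1 ContinuousLinearMap.norm_id_le

theorem traceLM_apply (T : traceClass H) : traceLM H T = trace (T : H →L[ℂ] H) := rfl

theorem traceNorm_of_nonneg {T : H →L[ℂ] H} (hT : 0 ≤ T) (hTc : IsTraceClass T) :
    traceNorm T = (trace T).re := by
  have h : Summable fun i => ⟪basis H i, T (basis H i)⟫_ℂ :=
    summable_inner (C := 1) hTc ContinuousLinearMap.norm_id_le
  rw [traceNorm, trace, Complex.re_tsum h, CFC.abs_of_nonneg T hT]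

theorem trace_re_nonneg {T : H →L[ℂ] H} (hT : 0 ≤ T) (hTc : IsTraceClass T) :
    0 ≤ (trace T).re :=
  traceNorm_of_nonneg hT hTc ▸ traceNorm_nonneg T

/-- T⁺ = (|T| + T) / 2, and both summands are trace class. -/
theorem IsTraceClass.posPart {T : H →L[ℂ] H} (hT : IsTraceClass T) (hsa : IsSelfAdjoint T) :
    IsTraceClass T⁺ := by
  have h := (hT.abs.add hT).smul (1 / 2)
  rw [CFC.abs_add_self T hsa, two_smul, ← two_smul ℂ, smul_smul] at h
  simpa using h

theorem IsTraceClass.negPart {T : H →L[ℂ] H} (hT : IsTraceClass T) (hsa : IsSelfAdjoint T) :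
    IsTraceClass T⁻ := by
  rw [← CFC.posPart_neg]
  have h := hT.smul (-1)
  rw [neg_one_smul] at h
  exact h.posPart hsa.neg

/-- Jordan decomposition of a self-adjoint trace class operator. -/
theorem exists_jordan (X : traceClass H) (hX : IsSelfAdjoint (X : H →L[ℂ] H)) :
    ∃ A B : traceClass H, 0 ≤ (A : H →L[ℂ] H) ∧ 0 ≤ (B : H →L[ℂ] H) ∧ X = A - B ∧
      (B : H →L[ℂ] H) * (A : H →L[ℂ] H) = 0 ∧
      traceNorm (X : H →L[ℂ] H) = (traceLM H A).re + (traceLM H B).re := by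
  have hA := X.2.posPart hX
  have hB := X.2.negPart hX
  refine ⟨⟨_, hA⟩, ⟨_, hB⟩, CFC.posPart_nonneg _, CFC.negPart_nonneg _, ?_,
    CFC.negPart_mul_posPart _, ?_⟩
  · exact Subtype.ext (CFC.posPart_sub_negPart _ hX).symm
  · have h : CFC.abs (X : H →L[ℂ] H) = (X : H →L[ℂ] H)⁺ + (X : H →L[ℂ] H)⁻ :=
      (CFC.posPart_add_negPart (X : H →L[ℂ] H) hX).symm
    rw [← Complex.add_re, ← map_add, traceLM_apply, ← traceNorm_abs,
      traceNorm_of_nonneg (CFC.abs_nonneg (X : H →L[ℂ] H)) X.2.abs, h]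
    rfl

/-! ### Positivity and the discrimination inequality. -/

/-- In the order on ℂ, `0 ≤ z` forces z to be real, and over ℂ a real quadratic form already makes
the operator self-adjoint. -/
theorem nonneg_iff_inner {E : Type*} [NormedAddCommGroup E] [InnerProductSpace ℂ E]
    (T : E →L[ℂ] E) : 0 ≤ T ↔ ∀ x, 0 ≤ ⟪x, T x⟫_ℂ := by
  rw [ContinuousLinearMap.nonneg_iff_isPositive]
  refine ⟨fun h => h.inner_nonneg_right, fun h => ?_⟩
  rw [ContinuousLinearMap.isPositive_iff_complex]
  intro x
  have hx' : 0 ≤ ⟪T x, x⟫_ℂ := by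
    rw [← inner_conj_symm, starRingEnd_apply, star_nonneg_iff]
    exact h x
  obtain ⟨h1, h2⟩ := Complex.nonneg_iff.1 hx'
  exact ⟨Complex.ext rfl h2, h1⟩

theorem IsCompletelyPositive.nonneg {Φ : traceClass H →ₗ[ℂ] traceClass H}
    (hΦ : IsCompletelyPositive Φ) {T : traceClass H} (hT : 0 ≤ (T : H →L[ℂ] H)) :
    0 ≤ (Φ T : H →L[ℂ] H) := by
  rw [nonneg_iff_inner] at hT ⊢
  intro x
  have h := hΦ 1 (fun _ _ => T) (fun y => by simpa using hT (y 0)) fun _ => x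
  simpa using h

theorem Instrument.trace_re_nonneg {r : ℕ} (M : Instrument H r) (j : Fin r) {T : traceClass H}
    (hT : 0 ≤ (T : H →L[ℂ] H)) : 0 ≤ (traceLM H (M.map j T)).re :=
  QuantumDiscrimination.trace_re_nonneg ((M.completelyPositive j).nonneg hT) (M.map j T).2

theorem Instrument.sum_traceLM {r : ℕ} (M : Instrument H r) (T : traceClass H) :
    ∑ j, (traceLM H (M.map j T)).re = (traceLM H T).re := by
  rw [← Complex.re_sum]
  exact congrArg Complex.re (M.sum_trace T)

theorem Instrument.trace_re_le {r : ℕ} (M : Instrument H r) (j : Fin r) {T : traceClass H}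
    (hT : 0 ≤ (T : H →L[ℂ] H)) : (traceLM H (M.map j T)).re ≤ (traceLM H T).re := by
  rw [← M.sum_traceLM T]
  exact Finset.single_le_sum (f := fun j => (traceLM H (M.map j T)).re)
    (fun k _ => M.trace_re_nonneg k hT) (Finset.mem_univ j)

/-- Write X = A - B with A, B ≥ 0 and ‖X‖₁ = tr A + tr B. Then tr M(i)[A] ≤ tr A and tr M(j)[B] ≤ tr
B, and the two remaining terms enter with a minus sign. -/
theorem Instrument.sub_le_traceNorm {r : ℕ} (M : Instrument H r) (i j : Fin r) (X : traceClass H)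
    (hX : IsSelfAdjoint (X : H →L[ℂ] H)) :
    (traceLM H (M.map i X)).re - (traceLM H (M.map j X)).re ≤ traceNorm (X : H →L[ℂ] H) := by
  obtain ⟨A, B, hA, hB, hAB, -, hn⟩ := exists_jordan X hX
  rw [hn, hAB]
  simp only [map_sub, Complex.sub_re]
  linarith [M.trace_re_le i hA, M.trace_re_le j hB, M.trace_re_nonneg j hA,
    M.trace_re_nonneg i hB]

theorem sum_sum_eq_sum_Ioi {r : ℕ} (f : Fin r → Fin r → ℝ) (hf : ∀ i, f i i = 0) :
    ∑ i, ∑ j, f i j = ∑ i, ∑ j ∈ Finset.Ioi i, (f i j + f j i) := by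
  have h : ∀ i, ∑ j, f i j = ∑ j ∈ Finset.Ioi i, f i j + ∑ j ∈ Finset.Iio i, f i j := by
    intro i
    have hu : (Finset.univ : Finset (Fin r)) = insert i (Finset.Ioi i ∪ Finset.Iio i) := by
      ext j
      simp only [Finset.mem_univ, Finset.mem_insert, Finset.mem_union, Finset.mem_Ioi,
        Finset.mem_Iio, true_iff]
      rcases lt_trichotomy i j with h | h | h <;> simp [h]
    rw [hu, Finset.sum_insert (by simp), hf, zero_add, Finset.sum_union]
    rw [Finset.disjoint_left]
    intro j h1 h2
    exact lt_asymm (Finset.mem_Ioi.1 h1) (Finset.mem_Iio.1 h2)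
  simp_rw [h, Finset.sum_add_distrib]
  congr 1
  exact Finset.sum_comm' fun i j => by simp

/-- The discrimination bound for an arbitrary family of self-adjoint trace class operators. -/
theorem Instrument.mul_sum_le {r : ℕ} (M : Instrument H r) (σ : Fin r → traceClass H)
    (hσ : ∀ j, IsSelfAdjoint (σ j : H →L[ℂ] H)) :
    r * ∑ j, (traceLM H (M.map j (σ j))).re ≤ ∑ j, (traceLM H (σ j)).re +
      ∑ i, ∑ j ∈ Finset.Ioi i, traceNorm ((σ i - σ j : traceClass H) : H →L[ℂ] H) := by
  have h1 : (r : ℝ) * ∑ j, (traceLM H (M.map j (σ j))).re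
      = ∑ i, ∑ _j : Fin r, (traceLM H (M.map i (σ i))).re := by
    simp [Finset.mul_sum]
  have h2 : ∑ j, (traceLM H (σ j)).re = ∑ i, ∑ j, (traceLM H (M.map i (σ j))).re := by
    rw [Finset.sum_comm]
    exact Finset.sum_congr rfl fun j _ => (M.sum_traceLM _).symm
  -- The difference is now a double sum of tr M(i)[σ_i] - tr M(i)[σ_j], zero on the diagonal, so (i,
  -- j) can be paired with (j, i).
  rw [← sub_le_iff_le_add', h1, h2, ← Finset.sum_sub_distrib]
  simp_rw [← Finset.sum_sub_distrib]
  rw [sum_sum_eq_sum_Ioi _ fun i => sub_self _]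
  refine Finset.sum_le_sum fun i _ => Finset.sum_le_sum fun j _ => ?_
  have h := M.sub_le_traceNorm i j (σ i - σ j) ((hσ i).sub (hσ j))
  simp only [map_sub, Complex.sub_re] at h
  linarith

/-! ### Positivity of the trace pairing and measure-and-prepare instruments. -/

theorem hasSum_norm_inner_sq (x : H) : HasSum (fun i => ‖⟪basis H i, x⟫_ℂ‖ ^ 2) (‖x‖ ^ 2) := by
  have h := Complex.hasSum_re ((basis H).hasSum_inner_mul_inner x x)
  convert h using 1
  · funext i
    rw [← inner_conj_symm x, RCLike.conj_mul]
    norm_cast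
  · rw [inner_self_eq_norm_sq_to_K]
    norm_cast

/-- Swapping the Hilbert–Schmidt inner product of two operators into that of their adjoints. -/
theorem tsum_inner_star {A B : H →L[ℂ] H} (hA : Summable fun i => ‖A (basis H i)‖ ^ 2)
    (hB : Summable fun i => ‖B (basis H i)‖ ^ 2) :
    ∑' i, ⟪A (basis H i), B (basis H i)⟫_ℂ =
      ∑' i, ⟪star B (basis H i), star A (basis H i)⟫_ℂ := by
  have expand : ∀ (C D : H →L[ℂ] H) i, ⟪C (basis H i), D (basis H i)⟫_ℂ =
      ∑' k, ⟪C (basis H i), basis H k⟫_ℂ * ⟪basis H k, D (basis H i)⟫_ℂ := fun C D i =>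
    ((basis H).tsum_inner_mul_inner _ _).symm
  have coeff : ∀ C : H →L[ℂ] H, Summable (fun i => ‖C (basis H i)‖ ^ 2) →
      Summable fun p : basisIndex H × basisIndex H =>
        ‖⟪basis H p.2, C (basis H p.1)⟫_ℂ‖ ^ 2 := by
    intro C hC
    have hk := fun i => hasSum_norm_inner_sq (C (basis H i))
    refine (summable_prod_of_nonneg fun p => by positivity).2 ⟨fun i => (hk i).summable, ?_⟩
    exact hC.congr fun i => (hk i).tsum_eq.symm
  -- Absolute convergence of the double expansion, from |ab| ≤ |a|² + |b|², licenses exchanging the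
  -- two sums.
  have hsum : Summable (Function.uncurry fun i k =>
      ⟪A (basis H i), basis H k⟫_ℂ * ⟪basis H k, B (basis H i)⟫_ℂ) := by
    refine .of_norm_bounded ((coeff A hA).add (coeff B hB)) fun p => ?_
    rw [Function.uncurry, norm_mul, norm_inner_symm]
    nlinarith [sq_nonneg (‖⟪basis H p.2, A (basis H p.1)⟫_ℂ‖ - ‖⟪basis H p.2, B (basis H p.1)⟫_ℂ‖),
      sq_nonneg ‖⟪basis H p.2, A (basis H p.1)⟫_ℂ‖, sq_nonneg ‖⟪basis H p.2, B (basis H p.1)⟫_ℂ‖]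
  simp_rw [expand]
  rw [← hsum.tsum_comm]
  refine tsum_congr fun i => tsum_congr fun k => ?_
  rw [ContinuousLinearMap.star_eq_adjoint, ContinuousLinearMap.star_eq_adjoint,
    ContinuousLinearMap.adjoint_inner_left, ContinuousLinearMap.adjoint_inner_right, mul_comm]

/-- With R = S^{1/2}, tr(E S) = tr(R E R) = Σ ⟨R e, E R e⟩. The cyclic step is `tsum_inner_star`
applied to the Hilbert–Schmidt operators R E and R. -/
theorem traceMul_nonneg {E : H →L[ℂ] H} (hE : 0 ≤ E) (hE1 : ‖E‖ ≤ 1) {S : traceClass H}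
    (hS : 0 ≤ (S : H →L[ℂ] H)) : 0 ≤ traceMul E hE1 S := by
  set R := CFC.sqrt (CFC.abs (S : H →L[ℂ] H)) with hR
  have hRsa : star R = R := (CFC.sqrt_nonneg (CFC.abs (S : H →L[ℂ] H))).star_eq
  have hRR : (S : H →L[ℂ] H) = R * R := by
    rw [hR, CFC.sqrt_mul_sqrt_self _ (CFC.abs_nonneg (S : H →L[ℂ] H)),
      CFC.abs_of_nonneg (S : H →L[ℂ] H) hS]
  have hsum : ∀ C : H →L[ℂ] H, ‖C‖ ≤ 1 → Summable fun i => ‖(R * C) (basis H i)‖ ^ 2 :=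
    fun C hC => summable_of_sum_le (fun _ => by positivity) (sum_norm_sq_le _ S.2 C hC)
  have hEsa : star E = E := hE.star_eq
  have h1 : traceMul E hE1 S = ∑' i, ⟪(R * E) (basis H i), (R * 1) (basis H i)⟫_ℂ := by
    refine tsum_congr fun i => ?_
    rw [hRR, mul_one, _root_.mul_apply_eq_comp, _root_.mul_apply_eq_comp]
    nth_rw 1 [← hRsa]
    rw [ContinuousLinearMap.star_eq_adjoint, ContinuousLinearMap.adjoint_inner_right]
  rw [h1, tsum_inner_star (hsum E hE1) (hsum 1 ContinuousLinearMap.norm_id_le)]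
  refine tsum_nonneg fun i => ?_
  rw [mul_one, star_mul, hRsa, hEsa, _root_.mul_apply_eq_comp]
  exact (nonneg_iff_inner E).1 hE _

theorem isTraceClass_rankOne_self (v : H) : IsTraceClass (InnerProductSpace.rankOne ℂ v v) := by
  have h0 : 0 ≤ InnerProductSpace.rankOne ℂ v v :=
    (ContinuousLinearMap.nonneg_iff_isPositive _).2 (InnerProductSpace.isPositive_rankOne_self v)
  refine (hasSum_norm_inner_sq v).summable.congr fun i => ?_
  rw [CFC.abs_of_nonneg _ h0, InnerProductSpace.rankOne_apply, inner_smul_right,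
    ← inner_conj_symm v, RCLike.conj_mul]
  norm_cast

theorem trace_rankOne_self (v : H) :
    trace (InnerProductSpace.rankOne ℂ v v) = ⟪v, v⟫_ℂ := by
  rw [← (basis H).tsum_inner_mul_inner v v]
  exact tsum_congr fun i => by rw [InnerProductSpace.rankOne_apply, inner_smul_right]

/-- The instrument which measures the POVM `E` and then prepares the pure state `v`. -/
noncomputable def measurePrepare {r : ℕ} (E : Fin r → H →L[ℂ] H) (hE : ∀ j, 0 ≤ E j)
    (hE1 : ∀ j, ‖E j‖ ≤ 1) (hsum : ∑ j, E j = 1) (v : H) (hv : ‖v‖ = 1) : Instrument H r where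
  map j := (traceMul (E j) (hE1 j)).smulRight ⟨_, isTraceClass_rankOne_self v⟩
  completelyPositive j := by
    intro n T hT x
    set c : Fin n → ℂ := fun i => ⟪v, x i⟫_ℂ with hc
    -- The block form of the image at x equals tr(E_j S) for this compressed operator S. The
    -- quadratic form of S at y is the block form of T at the vectors c_i y, so S ≥ 0.
    have hS : 0 ≤ ((∑ i, ∑ k, (star (c i) * c k) • T i k : traceClass H) : H →L[ℂ] H) := by
      rw [nonneg_iff_inner]
      intro y
      convert hT fun i => c i • y using 1
      simp only [Submodule.coe_sum, Submodule.coe_smul, _root_.sum_apply,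
        _root_.smul_apply, inner_sum, inner_smul_right, map_smul, inner_smul_left]
      refine Finset.sum_congr rfl fun i _ => Finset.sum_congr rfl fun k _ => ?_
      simp only [starRingEnd_apply]
      ring
    convert traceMul_nonneg (hE j) (hE1 j) hS using 1
    simp only [map_sum, map_smul, smul_eq_mul]
    refine Finset.sum_congr rfl fun i _ => Finset.sum_congr rfl fun k _ => ?_
    simp only [LinearMap.smulRight_apply, Submodule.coe_smul, _root_.smul_apply,
      InnerProductSpace.rankOne_apply, inner_smul_right, hc, ← starRingEnd_apply, inner_conj_symm]
    ring
  bounded j := by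
    refine ⟨traceNorm (InnerProductSpace.rankOne ℂ v v), fun T => ?_⟩
    rw [LinearMap.smulRight_apply, Submodule.coe_smul, traceNorm_smul, mul_comm]
    exact mul_le_mul_of_nonneg_left (norm_traceMul_le _ _ T) (traceNorm_nonneg _)
  sum_trace T := by
    have h : ∀ j, trace (((traceMul (E j) (hE1 j)).smulRight
        (⟨_, isTraceClass_rankOne_self v⟩ : traceClass H) T : traceClass H) : H →L[ℂ] H) =
        traceMul (E j) (hE1 j) T := by
      intro j
      rw [← traceLM_apply, LinearMap.smulRight_apply, map_smul, traceLM_apply,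
        trace_rankOne_self, inner_self_eq_norm_sq_to_K, hv]
      simp
    simp_rw [h]
    rw [trace]
    simp only [traceMul, LinearMap.coe_mk, AddHom.coe_mk]
    rw [← Summable.tsum_finsetSum fun j _ => summable_inner T.2 (hE1 j)]
    refine tsum_congr fun i => ?_
    rw [← sum_inner, ← _root_.sum_apply, hsum]
    rfl

theorem measurePrepare_trace {r : ℕ} (E : Fin r → H →L[ℂ] H) (hE : ∀ j, 0 ≤ E j)
    (hE1 : ∀ j, ‖E j‖ ≤ 1) (hsum : ∑ j, E j = 1) (v : H) (hv : ‖v‖ = 1) (j : Fin r)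
    (T : traceClass H) :
    traceLM H ((measurePrepare E hE hE1 hsum v hv).map j T) = traceMul (E j) (hE1 j) T := by
  rw [measurePrepare, LinearMap.smulRight_apply, map_smul, traceLM_apply,
    trace_rankOne_self, inner_self_eq_norm_sq_to_K, hv]
  simp

/-! ### Helstrom's measurement. -/

/-- A two-outcome instrument saturating the discrimination bound (Helstrom's measurement). -/
theorem exists_instrument_two (σ τ : traceClass H) (hσ : IsSelfAdjoint (σ : H →L[ℂ] H))
    (hτ : IsSelfAdjoint (τ : H →L[ℂ] H)) (v : H) (hv : ‖v‖ = 1) :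
    ∃ M : Instrument H 2, (traceLM H (M.map 0 σ)).re + (traceLM H (M.map 1 τ)).re =
      1 / 2 * ((traceLM H σ).re + (traceLM H τ).re +
        traceNorm ((σ - τ : traceClass H) : H →L[ℂ] H)) := by
  obtain ⟨A, B, hA, hB, hAB, hBA, hn⟩ := exists_jordan (σ - τ) (hσ.sub hτ)
  -- The projection P onto ker B fixes the range of A because B A = 0, and kills the range of B
  -- because B is self-adjoint. Hence tr(P(σ - τ)) = tr A.
  set K := LinearMap.ker ((B : H →L[ℂ] H) : H →ₗ[ℂ] H) with hK
  have : CompleteSpace K := (ContinuousLinearMap.isClosed_ker (B : H →L[ℂ] H)).completeSpace_coe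
  set P := K.starProjection with hP
  have hPsp : IsStarProjection P := isStarProjection_starProjection
  have hQsp : IsStarProjection (1 - P) := hPsp.one_sub
  have hPA : ∀ x, P ((A : H →L[ℂ] H) x) = (A : H →L[ℂ] H) x := fun x =>
    Submodule.starProjection_eq_self_iff.2 (by
      rw [hK, LinearMap.mem_ker]
      exact congrArg (fun F : H →L[ℂ] H => F x) hBA)
  have hBsa : star (B : H →L[ℂ] H) = B := hB.star_eq
  have hPB : ∀ x, P ((B : H →L[ℂ] H) x) = 0 := fun x => by
    rw [hP, Submodule.starProjection_apply_eq_zero_iff, Submodule.mem_orthogonal]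
    intro u hu
    rw [← hBsa, ContinuousLinearMap.star_eq_adjoint, ContinuousLinearMap.adjoint_inner_right]
    have : (B : H →L[ℂ] H) u = 0 := hu
    rw [this, inner_zero_left]
  have hP1 : ‖P‖ ≤ 1 := K.starProjection_norm_le
  have hQ1 : ‖1 - P‖ ≤ 1 := hQsp.norm_le
  set E : Fin 2 → H →L[ℂ] H := ![P, 1 - P]
  have hE : ∀ j, 0 ≤ E j := Fin.forall_fin_two.2 ⟨hPsp.nonneg, hQsp.nonneg⟩
  have hE1 : ∀ j, ‖E j‖ ≤ 1 := Fin.forall_fin_two.2 ⟨hP1, hQ1⟩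
  have hsum : ∑ j, E j = 1 := by simp [E, Fin.sum_univ_two]
  have hX : traceMul P hP1 (σ - τ) = traceLM H A := by
    refine tsum_congr fun i => ?_
    rw [hAB, hP, Submodule.inner_starProjection_left_eq_right, ← hP, Submodule.coe_sub,
      _root_.sub_apply, map_sub, hPA, hPB, sub_zero]
    rfl
  refine ⟨measurePrepare E hE hE1 hsum v hv, ?_⟩
  -- Eliminating the second outcome turns the success sum into tr τ + tr(P(σ - τ)) = tr τ + tr A;
  -- then tr σ - tr τ = tr A - tr B finishes.
  have hM := (measurePrepare E hE hE1 hsum v hv).sum_traceLM τ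
  have h0 := measurePrepare_trace E hE hE1 hsum v hv 0
  rw [Fin.sum_univ_two, h0] at hM
  rw [h0, hn]
  have h2 : ∀ T, traceMul (E 0) (hE1 0) T = traceMul P hP1 T := fun _ => rfl
  rw [h2] at hM ⊢
  rw [map_sub] at hX
  have hX' := congrArg Complex.re hX
  have hd := congrArg (fun T => (traceLM H T).re) hAB
  simp only [map_sub, Complex.sub_re] at hd hX'
  linarith

/-! ### Compactness of the set of instruments in finite dimension. -/

section FiniteDimensional

variable [FiniteDimensional ℂ H]

instance : Finite (basisIndex H) :=
  (basis H).orthonormal.linearIndependent.finite_of_isNoetherian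

theorem isTraceClass_of_finiteDimensional (T : H →L[ℂ] H) : IsTraceClass T :=
  Summable.of_finite

theorem traceNorm_le_card_mul (T : H →L[ℂ] H) :
    traceNorm T ≤ Nat.card (basisIndex H) * ‖T‖ := by
  have := Fintype.ofFinite (basisIndex H)
  rw [traceNorm, tsum_fintype, Nat.card_eq_fintype_card, ← nsmul_eq_mul, ← Finset.card_univ]
  refine Finset.sum_le_card_nsmul _ _ _ fun i _ => (Complex.re_le_norm _).trans ?_
  refine (norm_inner_le_norm _ _).trans ?_
  have h := (CFC.abs T).le_opNorm (basis H i)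
  rw [(basis H).orthonormal.1 i, mul_one, CFC.norm_abs] at h
  rwa [(basis H).orthonormal.1 i, one_mul]

theorem continuous_traceNorm : Continuous (traceNorm : (H →L[ℂ] H) → ℝ) := by
  refine (LipschitzWith.of_le_add_mul (Nat.card (basisIndex H)) fun S T => ?_).continuous
  have h := traceNorm_add_le (isTraceClass_of_finiteDimensional T)
    (isTraceClass_of_finiteDimensional (S - T))
  rw [add_sub_cancel] at h
  refine h.trans (add_le_add_right ?_ _)
  rw [dist_eq_norm]
  exact_mod_cast traceNorm_le_card_mul (S - T)

/-- `traceClass H` carries the operator norm, which is equivalent to the trace norm here.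
Boundedness is therefore automatic and need not appear in `instrumentSet`. -/
theorem isTraceNormBounded_of_finiteDimensional (Φ : traceClass H →ₗ[ℂ] traceClass H) :
    IsTraceNormBounded Φ := by
  refine ⟨Nat.card (basisIndex H) * ‖LinearMap.toContinuousLinearMap Φ‖, fun T => ?_⟩
  refine (traceNorm_le_card_mul _).trans ?_
  rw [mul_assoc]
  refine mul_le_mul_of_nonneg_left ?_ (Nat.cast_nonneg _)
  refine ((LinearMap.toContinuousLinearMap Φ).le_opNorm T).trans ?_
  exact mul_le_mul_of_nonneg_left (norm_le_traceNorm T.2) (norm_nonneg _)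

variable (H) in
/-- Instruments as families of continuous linear maps. -/
def instrumentSet (r : ℕ) : Set (Fin r → traceClass H →L[ℂ] traceClass H) :=
  {f | (∀ j, IsCompletelyPositive (f j : traceClass H →ₗ[ℂ] traceClass H)) ∧
    ∀ T : traceClass H, ∑ j, traceLM H (f j T) = traceLM H T}

/-- The instrument given by a member of `instrumentSet`. -/
def instrumentOfMem {r : ℕ} {f : Fin r → traceClass H →L[ℂ] traceClass H}
    (hf : f ∈ instrumentSet H r) : Instrument H r where
  map j := f j
  completelyPositive := hf.1
  bounded _ := isTraceNormBounded_of_finiteDimensional _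
  sum_trace := hf.2

/-- The member of `instrumentSet` given by an instrument. -/
noncomputable def Instrument.toCLM {r : ℕ} (M : Instrument H r) :
    Fin r → traceClass H →L[ℂ] traceClass H :=
  fun j => LinearMap.toContinuousLinearMap (M.map j)

theorem instrumentOfMem_map {r : ℕ} {f : Fin r → traceClass H →L[ℂ] traceClass H}
    (hf : f ∈ instrumentSet H r) (j : Fin r) (T : traceClass H) :
    (instrumentOfMem hf).map j T = f j T := rfl

theorem Instrument.toCLM_apply {r : ℕ} (M : Instrument H r) (j : Fin r) (T : traceClass H) :
    M.toCLM j T = M.map j T := rfl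

theorem Instrument.toCLM_mem {r : ℕ} (M : Instrument H r) : M.toCLM ∈ instrumentSet H r :=
  ⟨M.completelyPositive, M.sum_trace⟩

theorem continuous_traceLM : Continuous (traceLM H) :=
  (traceLM H).continuous_of_finiteDimensional

theorem isClosed_instrumentSet (r : ℕ) : IsClosed (instrumentSet H r) := by
  have h : instrumentSet H r =
      (⋂ (j : Fin r) (n : ℕ) (T : Fin n → Fin n → traceClass H)
        (_ : ∀ x : Fin n → H, 0 ≤ ∑ i, ∑ k, ⟪x i, (T i k : H →L[ℂ] H) (x k)⟫_ℂ) (x : Fin n → H),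
        (fun f : Fin r → traceClass H →L[ℂ] traceClass H =>
          ∑ i, ∑ k, ⟪x i, (f j (T i k) : H →L[ℂ] H) (x k)⟫_ℂ) ⁻¹' Set.Ici 0) ∩
      ⋂ T : traceClass H, {f | ∑ j, traceLM H (f j T) = traceLM H T} := by
    ext f
    simp only [instrumentSet, IsCompletelyPositive, Set.mem_inter_iff, Set.mem_iInter,
      Set.mem_preimage, Set.mem_Ici, Set.mem_ofPred_eq]
    rfl
  rw [h]
  refine IsClosed.inter ?_ ?_
  · refine isClosed_iInter fun j => isClosed_iInter fun n => isClosed_iInter fun T =>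
      isClosed_iInter fun _ => isClosed_iInter fun x => isClosed_Ici.preimage ?_
    refine continuous_finsetSum _ fun i _ => continuous_finsetSum _ fun k _ => ?_
    have h : Continuous fun f : Fin r → traceClass H →L[ℂ] traceClass H =>
        (f j (T i k) : H →L[ℂ] H) := by fun_prop
    exact continuous_const.inner (h.clm_apply continuous_const)
  · refine isClosed_iInter fun T => isClosed_eq ?_ continuous_const
    exact continuous_finsetSum _ fun j _ => continuous_traceLM.comp (by fun_prop)

/-- For T ≥ 0 the operator norm of f_j T is at most its trace norm, which is its trace, hence at
most tr T independently of f. Positive operators span, so the bound extends to every T. -/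
theorem exists_norm_le_of_mem_instrumentSet (r : ℕ) (T : traceClass H) :
    ∃ C : ℝ, ∀ f ∈ instrumentSet H r, ∀ j, ‖f j T‖ ≤ C := by
  have key : ∀ S : H →L[ℂ] H, ∃ C : ℝ, ∀ f ∈ instrumentSet H r, ∀ j,
      ‖f j ⟨S, isTraceClass_of_finiteDimensional S⟩‖ ≤ C := by
    intro S
    have hS : S ∈ Submodule.span ℂ {a : H →L[ℂ] H | 0 ≤ a} := by
      rw [CStarAlgebra.span_nonneg]
      trivial
    induction hS using Submodule.span_induction with
    | mem S hS =>
      refine ⟨(traceLM H ⟨S, isTraceClass_of_finiteDimensional S⟩).re, fun f hf j => ?_⟩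
      have hS' : 0 ≤ ((⟨S, isTraceClass_of_finiteDimensional S⟩ : traceClass H) : H →L[ℂ] H) := hS
      refine (norm_le_traceNorm (f j _).2).trans ?_
      refine (traceNorm_of_nonneg ((hf.1 j).nonneg hS') (f j _).2).trans_le ?_
      exact (instrumentOfMem hf).trace_re_le j hS'
    | zero =>
      refine ⟨0, fun f _ j => ?_⟩
      have h : (⟨0, isTraceClass_of_finiteDimensional 0⟩ : traceClass H) = 0 := rfl
      rw [h, map_zero, norm_zero]
    | add A B _ _ hA hB =>
      obtain ⟨a, ha⟩ := hA
      obtain ⟨b, hb⟩ := hB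
      refine ⟨a + b, fun f hf j => ?_⟩
      have h : (⟨A + B, isTraceClass_of_finiteDimensional _⟩ : traceClass H) =
        ⟨A, isTraceClass_of_finiteDimensional _⟩ + ⟨B, isTraceClass_of_finiteDimensional _⟩ := rfl
      rw [h, map_add]
      exact (norm_add_le _ _).trans (add_le_add (ha f hf j) (hb f hf j))
    | smul c A _ hA =>
      obtain ⟨a, ha⟩ := hA
      refine ⟨‖c‖ * a, fun f hf j => ?_⟩
      have h : (⟨c • A, isTraceClass_of_finiteDimensional _⟩ : traceClass H) =
        c • ⟨A, isTraceClass_of_finiteDimensional _⟩ := rfl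
      rw [h, map_smul, norm_smul]
      exact mul_le_mul_of_nonneg_left (ha f hf j) (norm_nonneg _)
  exact key T

theorem isCompact_instrumentSet (r : ℕ) : IsCompact (instrumentSet H r) := by
  have : CompleteSpace (traceClass H) := FiniteDimensional.complete ℂ _
  have : ProperSpace (traceClass H →L[ℂ] traceClass H) :=
    FiniteDimensional.proper ℂ (traceClass H →L[ℂ] traceClass H)
  -- The pointwise bounds become one bound on operator norms; closed and bounded then means compact.
  obtain ⟨C, hC⟩ := banach_steinhaus
    (g := fun p : instrumentSet H r × Fin r => (p.1 : Fin r → traceClass H →L[ℂ] traceClass H) p.2)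
    fun T => (exists_norm_le_of_mem_instrumentSet r T).imp fun C h p => h p.1 p.1.2 p.2
  have hb : Bornology.IsBounded (instrumentSet H r) := by
    refine (isBounded_iff_forall_norm_le (E := Fin r → traceClass H →L[ℂ] traceClass H)).2
      ⟨max C 0, fun f hf => ?_⟩
    exact (pi_norm_le_iff_of_nonneg (le_max_right _ _)).2 fun j =>
      (hC (⟨f, hf⟩, j)).trans (le_max_left _ _)
  exact Metric.isCompact_of_isClosed_isBounded
    (α := Fin r → traceClass H →L[ℂ] traceClass H) (isClosed_instrumentSet r) hb

end FiniteDimensional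

/-! ### The two receivers: applying the inequality. -/

/-- On the zero space every trace is 0, so a state forces H ≠ 0. The unit vector serves as the state
prepared after measurement. -/
theorem IsState.exists_unit {ρ : traceClass H} (hρ : IsState ρ) : ∃ v : H, ‖v‖ = 1 := by
  by_contra! h
  have : Subsingleton H := by
    refine subsingleton_of_forall_eq 0 fun x => by_contra fun hx => h ((‖x‖⁻¹ : ℂ) • x) ?_
    exact_mod_cast norm_smul_inv_norm (𝕜 := ℂ) hx
  have h0 : trace (ρ : H →L[ℂ] H) = 0 := by
    rw [trace, ← tsum_zero]
    exact tsum_congr fun i => by rw [Subsingleton.elim (basis H i) 0, inner_zero_left]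
  exact zero_ne_one (h0.symm.trans hρ.2)

theorem IsState.nonneg {ρ : traceClass H} (hρ : IsState ρ) : 0 ≤ (ρ : H →L[ℂ] H) :=
  (ContinuousLinearMap.nonneg_iff_isPositive _).2 hρ.1

/-- The trivial measurement, always giving outcome 0. Nonemptiness is needed to bound suprema from
above and to extract maximisers. -/
theorem nonempty_instrument {r : ℕ} (hr : 0 < r) {v : H} (hv : ‖v‖ = 1) :
    Nonempty (Instrument H r) := by
  refine ⟨measurePrepare (Pi.single ⟨0, hr⟩ 1) (fun j => ?_) (fun j => ?_) ?_ v hv⟩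
  · rw [Pi.single_apply]
    split_ifs
    · exact zero_le_one
    · exact le_rfl
  · rw [Pi.single_apply]
    split_ifs
    · exact ContinuousLinearMap.norm_id_le
    · simp
  · simp

section Bounds

variable (Λ₁ Λ₂ : Channel H) {r : ℕ} (ρ : Fin r → traceClass H) (q : Fin r → ℝ)

/-- The weighted unnormalized state which the second receiver gets after outcome `j`. -/
noncomputable def received (M₁ : Instrument H r) (j : Fin r) : traceClass H :=
  Λ₂.map ((q j : ℂ) • M₁.map j (Λ₁.map (ρ j)))

theorem Channel.traceLM_map (Λ : Channel H) (T : traceClass H) :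
    traceLM H (Λ.map T) = traceLM H T :=
  Λ.trace_map T

theorem received_nonneg (hρ : ∀ j, IsState (ρ j)) (hq : ∀ j, 0 < q j) (M₁ : Instrument H r)
    (j : Fin r) : 0 ≤ (received Λ₁ Λ₂ ρ q M₁ j : H →L[ℂ] H) := by
  refine Λ₂.completelyPositive.nonneg ?_
  have h := (M₁.completelyPositive j).nonneg (Λ₁.completelyPositive.nonneg (hρ j).nonneg)
  have hqj : (0 : ℂ) ≤ q j := by exact_mod_cast (hq j).le
  exact smul_nonneg hqj h

theorem sum_trace_received (M₁ : Instrument H r) :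
    ∑ j, (traceLM H (received Λ₁ Λ₂ ρ q M₁ j)).re =
      successProb M₁ (fun j => Λ₁.map (ρ j)) q :=
  Finset.sum_congr rfl fun j _ => by
    rw [received, Channel.traceLM_map, map_smul, smul_eq_mul, Complex.re_ofReal_mul, traceLM_apply]

theorem twoSuccessProb_eq (M₁ M₂ : Instrument H r) :
    twoSuccessProb Λ₁ Λ₂ M₁ M₂ ρ q =
      ∑ j, (traceLM H (M₂.map j (received Λ₁ Λ₂ ρ q M₁ j))).re :=
  Finset.sum_congr rfl fun j _ => by
    rw [received, map_smul, map_smul, map_smul, smul_eq_mul, Complex.re_ofReal_mul]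
    rfl

theorem firstReceiverBound_eq (M₁ : Instrument H r) :
    firstReceiverBound Λ₁ Λ₂ ρ q M₁ = successProb M₁ (fun j => Λ₁.map (ρ j)) q +
      ∑ i, ∑ j ∈ Finset.Ioi i, traceNorm ((received Λ₁ Λ₂ ρ q M₁ i - received Λ₁ Λ₂ ρ q M₁ j :
        traceClass H) : H →L[ℂ] H) := by
  simp only [firstReceiverBound, received, map_sub]

theorem mul_twoSuccessProb_le (hρ : ∀ j, IsState (ρ j)) (hq : ∀ j, 0 < q j)
    (M₁ M₂ : Instrument H r) :
    r * twoSuccessProb Λ₁ Λ₂ M₁ M₂ ρ q ≤ firstReceiverBound Λ₁ Λ₂ ρ q M₁ := by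
  rw [twoSuccessProb_eq, firstReceiverBound_eq, ← sum_trace_received Λ₁ Λ₂]
  exact M₂.mul_sum_le _ fun j => (received_nonneg Λ₁ Λ₂ ρ q hρ hq M₁ j).isSelfAdjoint

theorem successProb_le_one (hρ : ∀ j, IsState (ρ j)) (hq : ∀ j, 0 < q j) (hq1 : ∑ j, q j = 1)
    (M₁ : Instrument H r) : successProb M₁ (fun j => Λ₁.map (ρ j)) q ≤ 1 := by
  rw [← hq1]
  refine Finset.sum_le_sum fun j _ => ?_
  have h := M₁.trace_re_le j (Λ₁.completelyPositive.nonneg (hρ j).nonneg)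
  rw [Channel.traceLM_map, traceLM_apply, traceLM_apply, (hρ j).2, Complex.one_re] at h
  exact mul_le_of_le_one_right (hq j).le h

theorem traceNorm_sub_le_of_nonneg {A B : traceClass H} (hA : 0 ≤ (A : H →L[ℂ] H))
    (hB : 0 ≤ (B : H →L[ℂ] H)) :
    traceNorm ((A - B : traceClass H) : H →L[ℂ] H) ≤ (traceLM H A).re + (traceLM H B).re := by
  have h := traceNorm_add_le A.2 (-B).2
  rw [← Submodule.coe_add, ← sub_eq_add_neg, Submodule.coe_neg, traceNorm_neg,
    traceNorm_of_nonneg hA A.2, traceNorm_of_nonneg hB B.2] at h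
  exact h

theorem firstReceiverBound_le (hρ : ∀ j, IsState (ρ j)) (hq : ∀ j, 0 < q j) (hq1 : ∑ j, q j = 1)
    (M₁ : Instrument H r) :
    firstReceiverBound Λ₁ Λ₂ ρ q M₁ ≤ 1 + ∑ i : Fin r, ∑ _j ∈ Finset.Ioi i, 2 := by
  have h1 := successProb_le_one Λ₁ ρ q hρ hq hq1 M₁
  have hn := received_nonneg Λ₁ Λ₂ ρ q hρ hq M₁
  -- Each received operator is positive with trace at most the total, hence at most 1; so each pair
  -- contributes at most 2.
  have h2 : ∀ j, (traceLM H (received Λ₁ Λ₂ ρ q M₁ j)).re ≤ 1 := fun j => by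
    refine le_trans ?_ (sum_trace_received Λ₁ Λ₂ ρ q M₁ ▸ h1)
    exact Finset.single_le_sum (f := fun j => (traceLM H (received Λ₁ Λ₂ ρ q M₁ j)).re)
      (fun k _ => trace_re_nonneg (hn k) (received Λ₁ Λ₂ ρ q M₁ k).2) (Finset.mem_univ j)
  rw [firstReceiverBound_eq]
  refine add_le_add h1 (Finset.sum_le_sum fun i _ => Finset.sum_le_sum fun j _ => ?_)
  linarith [traceNorm_sub_le_of_nonneg (hn i) (hn j), h2 i, h2 j]

theorem mul_successProb_le (hρ : ∀ j, IsState (ρ j)) (hq : ∀ j, 0 < q j) (hq1 : ∑ j, q j = 1)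
    (M₁ : Instrument H r) :
    r * successProb M₁ (fun j => Λ₁.map (ρ j)) q ≤ 1 + ∑ i, ∑ j ∈ Finset.Ioi i,
      traceNorm (Λ₁.map ((q i : ℂ) • ρ i - (q j : ℂ) • ρ j) : H →L[ℂ] H) := by
  have hn : ∀ j, 0 ≤ (Λ₁.map ((q j : ℂ) • ρ j) : H →L[ℂ] H) := fun j => by
    refine Λ₁.completelyPositive.nonneg ?_
    have hqj : (0 : ℂ) ≤ q j := by exact_mod_cast (hq j).le
    exact smul_nonneg hqj (hρ j).nonneg
  have h := M₁.mul_sum_le (fun j => Λ₁.map ((q j : ℂ) • ρ j)) fun j => (hn j).isSelfAdjoint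
  have e1 : ∑ j, (traceLM H (M₁.map j (Λ₁.map ((q j : ℂ) • ρ j)))).re =
      successProb M₁ (fun j => Λ₁.map (ρ j)) q :=
    Finset.sum_congr rfl fun j _ => by
      rw [map_smul, map_smul, map_smul, smul_eq_mul, Complex.re_ofReal_mul, traceLM_apply]
  have e2 : ∑ j, (traceLM H (Λ₁.map ((q j : ℂ) • ρ j))).re = 1 := by
    rw [← hq1]
    refine Finset.sum_congr rfl fun j _ => ?_
    rw [Channel.traceLM_map, map_smul, smul_eq_mul, Complex.re_ofReal_mul, traceLM_apply, (hρ j).2,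
      Complex.one_re, mul_one]
  rw [e1, e2] at h
  simpa only [map_sub] using h

theorem bddAbove_firstReceiverBound (hρ : ∀ j, IsState (ρ j)) (hq : ∀ j, 0 < q j)
    (hq1 : ∑ j, q j = 1) : BddAbove (Set.range (firstReceiverBound Λ₁ Λ₂ ρ q)) := by
  refine ⟨1 + ∑ i : Fin r, ∑ _j ∈ Finset.Ioi i, 2, ?_⟩
  rintro _ ⟨M₁, rfl⟩
  exact firstReceiverBound_le Λ₁ Λ₂ ρ q hρ hq hq1 M₁

theorem twoSuccessProb_le (hr : 0 < r) (hρ : ∀ j, IsState (ρ j)) (hq : ∀ j, 0 < q j)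
    (M₁ M₂ : Instrument H r) :
    twoSuccessProb Λ₁ Λ₂ M₁ M₂ ρ q ≤ (1 / (r : ℝ)) * firstReceiverBound Λ₁ Λ₂ ρ q M₁ := by
  have hr' : (0 : ℝ) < r := by exact_mod_cast hr
  rw [one_div, inv_mul_eq_div, le_div_iff₀' hr']
  exact mul_twoSuccessProb_le Λ₁ Λ₂ ρ q hρ hq M₁ M₂

theorem twoSuccessProb_le_iSup (hr : 0 < r) (hρ : ∀ j, IsState (ρ j)) (hq : ∀ j, 0 < q j)
    (hq1 : ∑ j, q j = 1) (M₁ M₂ : Instrument H r) :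
    twoSuccessProb Λ₁ Λ₂ M₁ M₂ ρ q ≤
      (1 / (r : ℝ)) * ⨆ M : Instrument H r, firstReceiverBound Λ₁ Λ₂ ρ q M :=
  (twoSuccessProb_le Λ₁ Λ₂ ρ q hr hρ hq M₁ M₂).trans
    (mul_le_mul_of_nonneg_left (le_ciSup (bddAbove_firstReceiverBound Λ₁ Λ₂ ρ q hρ hq hq1) M₁)
      (by positivity))

theorem bddAbove_twoSuccessProb (hr : 0 < r) (hρ : ∀ j, IsState (ρ j)) (hq : ∀ j, 0 < q j)
    (hq1 : ∑ j, q j = 1) :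
    BddAbove (Set.range fun M : Instrument H r × Instrument H r =>
      twoSuccessProb Λ₁ Λ₂ M.1 M.2 ρ q) := by
  refine ⟨(1 / (r : ℝ)) * ⨆ M : Instrument H r, firstReceiverBound Λ₁ Λ₂ ρ q M, ?_⟩
  rintro _ ⟨M, rfl⟩
  exact twoSuccessProb_le_iSup Λ₁ Λ₂ ρ q hr hρ hq hq1 M.1 M.2

theorem firstReceiverBound_two (ρ : Fin 2 → traceClass H) (q : Fin 2 → ℝ) (M₁ : Instrument H 2) :
    firstReceiverBound Λ₁ Λ₂ ρ q M₁ = successProb M₁ (fun j => Λ₁.map (ρ j)) q +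
      traceNorm (Λ₂.map ((q 0 : ℂ) • M₁.map 0 (Λ₁.map (ρ 0))
        - (q 1 : ℂ) • M₁.map 1 (Λ₁.map (ρ 1))) : H →L[ℂ] H) := by
  have h0 : Finset.Ioi (0 : Fin 2) = {1} := rfl
  have h1 : Finset.Ioi (1 : Fin 2) = ∅ := rfl
  rw [firstReceiverBound, Fin.sum_univ_two, h0, h1, Finset.sum_singleton, Finset.sum_empty,
    add_zero]

/-! ### Existence of maximisers. -/

variable [FiniteDimensional ℂ H]

theorem exists_forall_twoSuccessProb_le [Nonempty (Instrument H r)] :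
    ∃ M₁ M₂ : Instrument H r, ∀ N₁ N₂ : Instrument H r,
      twoSuccessProb Λ₁ Λ₂ N₁ N₂ ρ q ≤ twoSuccessProb Λ₁ Λ₂ M₁ M₂ ρ q := by
  have hF : Continuous fun f : (Fin r → traceClass H →L[ℂ] traceClass H) ×
      (Fin r → traceClass H →L[ℂ] traceClass H) =>
      ∑ j, q j * (traceLM H (f.2 j (Λ₂.map (f.1 j (Λ₁.map (ρ j)))))).re := by
    have hΛ : Continuous Λ₂.map := Λ₂.map.continuous_of_finiteDimensional
    refine continuous_finsetSum _ fun j _ => continuous_const.mul (Complex.continuous_re.comp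
      (continuous_traceLM.comp ?_))
    refine Continuous.clm_apply (by fun_prop) (hΛ.comp ?_)
    exact Continuous.clm_apply (by fun_prop) continuous_const
  obtain ⟨M₀⟩ := ‹Nonempty (Instrument H r)›
  obtain ⟨f, hf, hmax⟩ := ((isCompact_instrumentSet r).prod
    (isCompact_instrumentSet r)).exists_isMaxOn
    ⟨(M₀.toCLM, M₀.toCLM), M₀.toCLM_mem, M₀.toCLM_mem⟩ hF.continuousOn
  refine ⟨instrumentOfMem hf.1, instrumentOfMem hf.2, fun N₁ N₂ => ?_⟩
  have h := isMaxOn_iff.1 hmax (N₁.toCLM, N₂.toCLM) ⟨N₁.toCLM_mem, N₂.toCLM_mem⟩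
  simpa only [twoSuccessProb, consecutive, LinearMap.comp_apply, ← traceLM_apply,
    instrumentOfMem_map, Instrument.toCLM_apply] using h

theorem exists_forall_firstReceiverBound_le [Nonempty (Instrument H r)] :
    ∃ M₁ : Instrument H r, ∀ N₁ : Instrument H r,
      firstReceiverBound Λ₁ Λ₂ ρ q N₁ ≤ firstReceiverBound Λ₁ Λ₂ ρ q M₁ := by
  have hF : Continuous fun f : Fin r → traceClass H →L[ℂ] traceClass H =>
      ∑ j, q j * (traceLM H (f j (Λ₁.map (ρ j)))).re + ∑ i, ∑ j ∈ Finset.Ioi i,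
        traceNorm (Λ₂.map ((q i : ℂ) • f i (Λ₁.map (ρ i))
          - (q j : ℂ) • f j (Λ₁.map (ρ j))) : H →L[ℂ] H) := by
    have hΛ : Continuous Λ₂.map := Λ₂.map.continuous_of_finiteDimensional
    have happ : ∀ j, Continuous fun f : Fin r → traceClass H →L[ℂ] traceClass H =>
        f j (Λ₁.map (ρ j)) := fun j => Continuous.clm_apply (by fun_prop) continuous_const
    have hdiff : ∀ i j, Continuous fun f : Fin r → traceClass H →L[ℂ] traceClass H =>
        (q i : ℂ) • f i (Λ₁.map (ρ i)) - (q j : ℂ) • f j (Λ₁.map (ρ j)) := fun i j =>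
      ((happ i).const_smul (q i : ℂ)).sub ((happ j).const_smul (q j : ℂ))
    refine Continuous.add ?_ ?_
    · exact continuous_finsetSum _ fun j _ => continuous_const.mul (Complex.continuous_re.comp
        (continuous_traceLM.comp (happ j)))
    · exact continuous_finsetSum _ fun i _ => continuous_finsetSum _ fun j _ =>
        continuous_traceNorm.comp (continuous_subtype_val.comp
          (hΛ.comp (hdiff i j)))
  obtain ⟨M₀⟩ := ‹Nonempty (Instrument H r)›
  obtain ⟨f, hf, hmax⟩ := (isCompact_instrumentSet r).exists_isMaxOn
    ⟨M₀.toCLM, M₀.toCLM_mem⟩ hF.continuousOn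
  refine ⟨instrumentOfMem hf, fun N₁ => ?_⟩
  have h := isMaxOn_iff.1 hmax N₁.toCLM N₁.toCLM_mem
  simpa only [firstReceiverBound, successProb, ← traceLM_apply, instrumentOfMem_map,
    Instrument.toCLM_apply] using h

end Bounds

end QuantumDiscrimination

open QuantumDiscrimination in
theorem theorem3 {H : Type*} [NormedAddCommGroup H] [InnerProductSpace ℂ H] [CompleteSpace H]
    (Λ₁ Λ₂ : Channel H) :
    (∀ (r : ℕ), 2 ≤ r → ∀ (ρ : Fin r → traceClass H) (q : Fin r → ℝ),
      (∀ j, IsState (ρ j)) → (∀ j, 0 < q j) → ∑ j, q j = 1 →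
        -- both suprema are genuine
        IsLUB (Set.range fun M : Instrument H r × Instrument H r =>
          twoSuccessProb Λ₁ Λ₂ M.1 M.2 ρ q) (optSuccessProb Λ₁ Λ₂ ρ q) ∧
        IsLUB (Set.range fun M₁ : Instrument H r => firstReceiverBound Λ₁ Λ₂ ρ q M₁)
          (⨆ M₁ : Instrument H r, firstReceiverBound Λ₁ Λ₂ ρ q M₁) ∧
        -- in finite dimension they are maxima
        (FiniteDimensional ℂ H →
          (∃ M₁ M₂ : Instrument H r,
            twoSuccessProb Λ₁ Λ₂ M₁ M₂ ρ q = optSuccessProb Λ₁ Λ₂ ρ q) ∧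
          (∃ M₁ : Instrument H r, firstReceiverBound Λ₁ Λ₂ ρ q M₁ =
            ⨆ M₁ : Instrument H r, firstReceiverBound Λ₁ Λ₂ ρ q M₁)) ∧
        -- the upper bound on the optimal success probability
        optSuccessProb Λ₁ Λ₂ ρ q ≤
          (1 / (r : ℝ)) * ⨆ M₁ : Instrument H r, firstReceiverBound Λ₁ Λ₂ ρ q M₁ ∧
        -- the upper bound on the success probability of the first receiver
        (∀ M₁ : Instrument H r,
          successProb M₁ (fun j => Λ₁.map (ρ j)) q ≤
            (1 / (r : ℝ)) * (1 + ∑ i, ∑ j ∈ Finset.Ioi i,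
              traceNorm (Λ₁.map ((q i : ℂ) • ρ i - (q j : ℂ) • ρ j) : H →L[ℂ] H)))) ∧
    -- equality for two states
    (∀ (ρ : Fin 2 → traceClass H) (q : Fin 2 → ℝ),
      (∀ j, IsState (ρ j)) → (∀ j, 0 < q j) → ∑ j, q j = 1 →
        optSuccessProb Λ₁ Λ₂ ρ q =
          ⨆ M₁ : Instrument H 2, (1 / 2 : ℝ) *
            (successProb M₁ (fun j => Λ₁.map (ρ j)) q +
              traceNorm (Λ₂.map ((q 0 : ℂ) • M₁.map 0 (Λ₁.map (ρ 0))
                - (q 1 : ℂ) • M₁.map 1 (Λ₁.map (ρ 1))) : H →L[ℂ] H))) := by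
  refine ⟨fun r hr ρ q hρ hq hq1 => ?_, fun ρ q hρ hq hq1 => ?_⟩
  · have hr0 : 0 < r := by lia
    obtain ⟨v, hv⟩ := (hρ ⟨0, hr0⟩).exists_unit
    have hne : Nonempty (Instrument H r) := nonempty_instrument hr0 hv
    have hb := bddAbove_firstReceiverBound Λ₁ Λ₂ ρ q hρ hq hq1
    have hb2 := bddAbove_twoSuccessProb Λ₁ Λ₂ ρ q hr0 hρ hq hq1
    refine ⟨isLUB_ciSup hb2, isLUB_ciSup hb, fun _ => ⟨?_, ?_⟩, ?_, fun M₁ => ?_⟩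
    · obtain ⟨M₁, M₂, hM⟩ := exists_forall_twoSuccessProb_le Λ₁ Λ₂ ρ q
      exact ⟨M₁, M₂, le_antisymm (le_ciSup hb2 (M₁, M₂)) (ciSup_le fun N => hM N.1 N.2)⟩
    · obtain ⟨M₁, hM⟩ := exists_forall_firstReceiverBound_le Λ₁ Λ₂ ρ q
      exact ⟨M₁, le_antisymm (le_ciSup hb M₁) (ciSup_le hM)⟩
    · exact ciSup_le fun M => twoSuccessProb_le_iSup Λ₁ Λ₂ ρ q hr0 hρ hq hq1 M.1 M.2
    · have hr' : (0 : ℝ) < r := by exact_mod_cast hr0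
      rw [one_div, inv_mul_eq_div, le_div_iff₀' hr']
      exact mul_successProb_le Λ₁ ρ q hρ hq hq1 M₁
  · obtain ⟨v, hv⟩ := (hρ 0).exists_unit
    have hne : Nonempty (Instrument H 2) := nonempty_instrument two_pos hv
    have hB := firstReceiverBound_two Λ₁ Λ₂ ρ q
    have hb := bddAbove_firstReceiverBound Λ₁ Λ₂ ρ q hρ hq hq1
    have hb2 := bddAbove_twoSuccessProb Λ₁ Λ₂ ρ q two_pos hρ hq hq1
    simp_rw [← hB]
    refine le_antisymm ?_ (ciSup_le fun M₁ => ?_)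
    -- The factor 1/2 leaves the supremum, and the general bound at r = 2 applies.
    · rw [← Real.mul_iSup_of_nonneg (by norm_num)]
      refine ciSup_le fun M => ?_
      exact_mod_cast twoSuccessProb_le_iSup Λ₁ Λ₂ ρ q two_pos hρ hq hq1 M.1 M.2
    -- Helstrom's instrument for the two received operators makes the bound for this M₁ an attained
    -- value of the joint success probability.
    · obtain ⟨M₂, hM⟩ := exists_instrument_two _ _
        (received_nonneg Λ₁ Λ₂ ρ q hρ hq M₁ 0).isSelfAdjoint
        (received_nonneg Λ₁ Λ₂ ρ q hρ hq M₁ 1).isSelfAdjoint v hv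
      refine le_of_eq_of_le ?_ (le_ciSup hb2 (M₁, M₂))
      have hs := sum_trace_received Λ₁ Λ₂ ρ q M₁
      rw [Fin.sum_univ_two] at hs
      simp only [twoSuccessProb_eq, Fin.sum_univ_two]
      rw [hM, hs, hB, received, received, ← map_sub]
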